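/- For $\nu<0$ and $x\in\mathbb{R}$ let $$D_\nu(x)=\frac{e^{-x^2/4}}{\Gamma(-\nu)}\int_0^\infty t^{-\nu-1}e^{-t^2/2-xt}\,dt$$ be the parabolic cylinder function, and let $H_\nu$ be the Hermite function (a solution of $u''-2xu'+2\nu u=0$), which is determined by $D_\nu(x)=2^{-\nu/2}e^{-x^2/4}H_\nu(x/\sqrt2)$ for all $x\in\mathbb{R}$. Put $$\mathcal{R}_\nu(x)=\frac{H_{\nu-1}(x)^2}{H_\nu(x)H_{\nu-2}(x)},\qquad x\in\mathbb{R}.$$ Then for every $\nu<0$ $$1<\mathcal{R}_\nu(x)<\frac{\nu-1}{\nu}\qquad\text{for all }x\in\mathbb{R},$$ and these bounds are best possible: $\inf_{x\in\mathbb{R}}\mathcal{R}_\nu(x)=1$ and $\sup_{x\in\mathbb{R}}\mathcal{R}_\nu(x)=\frac{\nu-1}{\nu}$. In particular, the Turán-type inequality $$H_{\nu-1}(x)^2-H_\nu(x)H_{\nu-2}(x)>0$$ holds for all $x\in\mathbb{R}$. -/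

import Mathlib

open Real

noncomputable section

/-- The parabolic cylinder function `D_ν` (for `ν < 0`):
`D_ν(x) = e^{-x²/4} / Γ(-ν) * ∫_0^∞ t^{-ν-1} e^{-t²/2 - x t} dt`. -/
def parabolicCylinderD (ν x : ℝ) : ℝ :=
  Real.exp (-x ^ 2 / 4) / Real.Gamma (-ν) *
    ∫ t in Set.Ioi (0 : ℝ), t ^ (-ν - 1) * Real.exp (-t ^ 2 / 2 - x * t)

/-- The Hermite function `H_ν` (for `ν < 0`), normalised by the identity
`D_ν(x) = 2^{-ν/2} e^{-x²/4} H_ν(x / √2)`, solved for `H_ν`. -/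
def hermiteH (ν x : ℝ) : ℝ :=
  (2 : ℝ) ^ (ν / 2) * Real.exp (x ^ 2 / 2) * parabolicCylinderD ν (Real.sqrt 2 * x)

/-- The defining identity between the Hermite and the parabolic cylinder functions. -/
theorem parabolicCylinderD_eq (ν x : ℝ) :
    parabolicCylinderD ν x =
      (2 : ℝ) ^ (-ν / 2) * Real.exp (-x ^ 2 / 4) * hermiteH ν (x / Real.sqrt 2) := by
  have h2 : Real.sqrt 2 ≠ 0 := by positivity
  have hp : (2 : ℝ) ^ (-ν / 2) * (2 : ℝ) ^ (ν / 2) = 1 := by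
    rw [← Real.rpow_add (by norm_num)]
    ring_nf
    exact Real.rpow_zero 2
  have he : Real.exp (-x ^ 2 / 4) * Real.exp ((x / Real.sqrt 2) ^ 2 / 2) = 1 := by
    rw [← Real.exp_add, div_pow, Real.sq_sqrt (by norm_num)]
    ring_nf
    exact Real.exp_zero
  unfold hermiteH
  rw [mul_div_cancel₀ x h2]
  linear_combination (-(parabolicCylinderD ν x)) * hp -
    (2 : ℝ) ^ (-ν / 2) * (2 : ℝ) ^ (ν / 2) * parabolicCylinderD ν x * he

/-- The ratio `R_ν(x) = H_{ν-1}(x)² / (H_ν(x) H_{ν-2}(x))`. -/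
def hermiteRatio (ν x : ℝ) : ℝ :=
  hermiteH (ν - 1) x ^ 2 / (hermiteH ν x * hermiteH (ν - 2) x)

end

open Set MeasureTheory Filter Topology

/-! With ν = -s, y = √2 x and M_s = `gaussMellin s y`, the ratio is (s+1) M_{s+1}² / (s M_s
M_{s+2}), so everything concerns moments of one positive weight. The upper bound is Cauchy–Schwarz.
The lower bound, `gamma_moment_comparison`, compares the weight with the gamma weight c t^(s-1)
e^(-lt), for which the ratio is exactly 1.

Sharpness rests on M_{s+2} = s M_s - y M_{s+1}. As y → ∞ it squeezes the ratio to 1. For y → -∞, a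
smaller upper bound would make log (M_{s+1}/M_s) grow quadratically in |y|, although M_{s+1}/M_s
grows at most linearly. -/

/-- The integral `∫₀^∞ t^(s-1) e^(-t²/2 - y t) dt`. -/
noncomputable def gaussMellin (s y : ℝ) : ℝ :=
  ∫ t in Ioi (0 : ℝ), t ^ (s - 1) * exp (-t ^ 2 / 2 - y * t)

/-! ### Integrability, positivity and linear combinations of moments -/

theorem integrableOn_rpow_mul_exp_gauss {s : ℝ} (hs : -1 < s) (y : ℝ) :
    IntegrableOn (fun t : ℝ => t ^ s * exp (-t ^ 2 / 2 - y * t)) (Ioi 0) := by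
  -- Since (t/2 + y)² ≥ 0, the exponent is at most y² - t²/4.
  have h := (integrableOn_rpow_mul_exp_neg_mul_sq (b := 1 / 4) (by norm_num) hs).const_mul
    (exp (y ^ 2))
  refine Integrable.mono' h ?_ ?_
  · refine ContinuousOn.aestronglyMeasurable ?_ measurableSet_Ioi
    refine ContinuousOn.mul ?_ (by fun_prop)
    exact fun t ht => (continuousAt_rpow_const t s (Or.inl (ne_of_gt ht))).continuousWithinAt
  · refine (ae_restrict_iff' measurableSet_Ioi).2 (ae_of_all _ fun t ht => ?_)
    have ht0 : 0 ≤ t ^ s := rpow_nonneg (le_of_lt ht) s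
    rw [norm_of_nonneg (by positivity), mul_left_comm, ← exp_add]
    gcongr
    nlinarith [sq_nonneg (t / 2 + y)]

theorem integrableOn_gaussMellin {s : ℝ} (hs : 0 < s) (y : ℝ) :
    IntegrableOn (fun t : ℝ => t ^ (s - 1) * exp (-t ^ 2 / 2 - y * t)) (Ioi 0) :=
  integrableOn_rpow_mul_exp_gauss (by linarith) y

/-- The exceptional set absorbs the real roots of the quadratic factors used below. -/
theorem setIntegral_Ioi_pos {f : ℝ → ℝ} (hf : IntegrableOn f (Ioi 0)) {S : Set ℝ}
    (hS : S.Finite) (h0 : ∀ t ∈ Ioi (0 : ℝ), 0 ≤ f t)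
    (hpos : ∀ t ∈ Ioi (0 : ℝ), t ∉ S → 0 < f t) : 0 < ∫ t in Ioi (0 : ℝ), f t := by
  rw [setIntegral_pos_iff_support_of_nonneg_ae
    ((ae_restrict_iff' measurableSet_Ioi).2 (ae_of_all _ h0)) hf]
  have hsub : Ioi (0 : ℝ) \ S ⊆ Function.support f ∩ Ioi 0 :=
    fun t ht => ⟨(hpos t ht.1 ht.2).ne', ht.1⟩
  refine lt_of_lt_of_le ?_ (measure_mono hsub)
  rw [measure_sdiff_null (hS.measure_zero volume)]
  simp

theorem gaussMellin_pos {s : ℝ} (hs : 0 < s) (y : ℝ) : 0 < gaussMellin s y := by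
  have h : ∀ t ∈ Ioi (0 : ℝ), 0 < t ^ (s - 1) * exp (-t ^ 2 / 2 - y * t) := fun t ht =>
    mul_pos (rpow_pos_of_pos ht _) (exp_pos _)
  exact setIntegral_Ioi_pos (integrableOn_gaussMellin hs y) finite_empty
    (fun t ht => (h t ht).le) (fun t ht _ => h t ht)

theorem rpow_add_one_sub_one {s t : ℝ} (ht : 0 < t) :
    t ^ (s + 1 - 1) = t * t ^ (s - 1) := by
  rw [show s + 1 - 1 = 1 + (s - 1) by ring, rpow_add ht, rpow_one]

theorem rpow_add_two_sub_one {s t : ℝ} (ht : 0 < t) :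
    t ^ (s + 2 - 1) = t ^ 2 * t ^ (s - 1) := by
  rw [show s + 2 - 1 = 2 + (s - 1) by ring, rpow_add ht, rpow_two]

theorem integrableOn_quadratic_mul {g : ℝ → ℝ} {s : ℝ}
    (h0 : IntegrableOn (fun t => t ^ (s - 1) * g t) (Ioi 0))
    (h1 : IntegrableOn (fun t => t ^ (s + 1 - 1) * g t) (Ioi 0))
    (h2 : IntegrableOn (fun t => t ^ (s + 2 - 1) * g t) (Ioi 0)) (a b c : ℝ) :
    IntegrableOn (fun t => (a + b * t + c * t ^ 2) * (t ^ (s - 1) * g t)) (Ioi 0) := by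
  have h : IntegrableOn (fun t => a * (t ^ (s - 1) * g t) + b * (t ^ (s + 1 - 1) * g t) +
      c * (t ^ (s + 2 - 1) * g t)) (Ioi 0) :=
    ((h0.const_mul a).add (h1.const_mul b)).add (h2.const_mul c)
  refine h.congr_fun (fun t ht => ?_) measurableSet_Ioi
  simp only [rpow_add_one_sub_one ht, rpow_add_two_sub_one ht]
  ring

theorem integral_quadratic_mul {g : ℝ → ℝ} {s : ℝ}
    (h0 : IntegrableOn (fun t => t ^ (s - 1) * g t) (Ioi 0))
    (h1 : IntegrableOn (fun t => t ^ (s + 1 - 1) * g t) (Ioi 0))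
    (h2 : IntegrableOn (fun t => t ^ (s + 2 - 1) * g t) (Ioi 0)) (a b c : ℝ) :
    ∫ t in Ioi (0 : ℝ), (a + b * t + c * t ^ 2) * (t ^ (s - 1) * g t) =
      a * (∫ t in Ioi (0 : ℝ), t ^ (s - 1) * g t) +
      b * (∫ t in Ioi (0 : ℝ), t ^ (s + 1 - 1) * g t) +
      c * (∫ t in Ioi (0 : ℝ), t ^ (s + 2 - 1) * g t) := by
  have h01 : IntegrableOn (fun t => a * (t ^ (s - 1) * g t) + b * (t ^ (s + 1 - 1) * g t))
      (Ioi 0) := (h0.const_mul a).add (h1.const_mul b)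
  rw [← integral_const_mul, ← integral_const_mul, ← integral_const_mul,
    ← integral_add (h0.const_mul a) (h1.const_mul b), ← integral_add h01 (h2.const_mul c)]
  refine setIntegral_congr_fun measurableSet_Ioi fun t ht => ?_
  simp only [rpow_add_one_sub_one ht, rpow_add_two_sub_one ht]
  ring

theorem integral_quadratic_mul_gauss {s : ℝ} (hs : 0 < s) (y a b c : ℝ) :
    ∫ t in Ioi (0 : ℝ), (a + b * t + c * t ^ 2) * (t ^ (s - 1) * exp (-t ^ 2 / 2 - y * t)) =
      a * gaussMellin s y + b * gaussMellin (s + 1) y + c * gaussMellin (s + 2) y :=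
  integral_quadratic_mul (integrableOn_gaussMellin hs y)
    (integrableOn_gaussMellin (by linarith) y) (integrableOn_gaussMellin (by linarith) y) a b c

theorem integrableOn_quadratic_mul_gauss {s : ℝ} (hs : 0 < s) (y a b c : ℝ) :
    IntegrableOn
      (fun t => (a + b * t + c * t ^ 2) * (t ^ (s - 1) * exp (-t ^ 2 / 2 - y * t))) (Ioi 0) :=
  integrableOn_quadratic_mul (integrableOn_gaussMellin hs y)
    (integrableOn_gaussMellin (by linarith) y) (integrableOn_gaussMellin (by linarith) y) a b c

/-! ### Moment inequalities and the recurrence -/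

/-- Strict Cauchy–Schwarz inequality for the moments. -/
theorem gaussMellin_sq_lt {s : ℝ} (hs : 0 < s) (y : ℝ) :
    gaussMellin (s + 1) y ^ 2 < gaussMellin s y * gaussMellin (s + 2) y := by
  have hM := gaussMellin_pos hs y
  set r := gaussMellin (s + 1) y / gaussMellin s y with hr
  have hrM : gaussMellin (s + 1) y = r * gaussMellin s y := (div_mul_cancel₀ _ hM.ne').symm
  have hw : ∀ t ∈ Ioi (0 : ℝ), 0 < t ^ (s - 1) * exp (-t ^ 2 / 2 - y * t) := fun t ht =>
    mul_pos (rpow_pos_of_pos ht _) (exp_pos _)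
  have hq : ∀ t : ℝ, r ^ 2 + -2 * r * t + 1 * t ^ 2 = (t - r) ^ 2 := fun t => by ring
  have key := setIntegral_Ioi_pos (integrableOn_quadratic_mul_gauss hs y (r ^ 2) (-2 * r) 1)
    (finite_singleton r)
    (fun t ht => by rw [hq]; exact mul_nonneg (sq_nonneg _) (hw t ht).le)
    (fun t ht htr => by
      rw [hq]; exact mul_pos (sq_pos_of_ne_zero (sub_ne_zero.2 htr)) (hw t ht))
  rw [integral_quadratic_mul_gauss hs, hrM] at key
  rw [hrM]
  nlinarith [mul_pos hM key]

/-- Integrate the derivative of t^s e^(-t²/2 - yt) over (0, ∞); both boundary terms vanish, the one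
at 0 because s > 0. -/
theorem gaussMellin_add_two {s : ℝ} (hs : 0 < s) (y : ℝ) :
    gaussMellin (s + 2) y = s * gaussMellin s y - y * gaussMellin (s + 1) y := by
  have hderiv : ∀ t ∈ Ioi (0 : ℝ), HasDerivAt (fun t : ℝ => t ^ s * exp (-t ^ 2 / 2 - y * t))
      ((s + -y * t + -1 * t ^ 2) * (t ^ (s - 1) * exp (-t ^ 2 / 2 - y * t))) t := by
    intro t ht
    have h1 := hasDerivAt_rpow_const (x := t) (p := s) (Or.inl (ne_of_gt ht))
    have h2 : HasDerivAt (fun t : ℝ => -t ^ 2 / 2 - y * t) (-t - y) t := by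
      have := (((hasDerivAt_id t).pow 2).neg.div_const 2).sub ((hasDerivAt_id t).const_mul y)
      refine this.congr_deriv ?_
      simp only [id_eq]
      norm_num
      ring
    refine (h1.mul h2.exp).congr_deriv ?_
    have := rpow_add_one_sub_one (s := s) ht
    rw [add_sub_cancel_right] at this
    rw [this]; ring
  have hint := integrableOn_quadratic_mul_gauss hs y s (-y) (-1)
  have hF := integrableOn_rpow_mul_exp_gauss (s := s) (by linarith) y
  have hlim := tendsto_zero_of_hasDerivAt_of_integrableOn_Ioi hderiv hint hF
  have hc : ContinuousWithinAt (fun t : ℝ => t ^ s * exp (-t ^ 2 / 2 - y * t)) (Ici 0) 0 := by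
    have := continuousAt_rpow_const 0 s (Or.inr hs.le)
    exact (this.mul (by fun_prop)).continuousWithinAt
  have h := integral_Ioi_of_hasDerivAt_of_tendsto hc hderiv hint hlim
  rw [integral_quadratic_mul_gauss hs, zero_rpow hs.ne'] at h
  linarith

/-- Take the gamma weight with the same zeroth and first moments. If e^u and e^v are the exponential
factors of the two weights, then (u - v)(e^u - e^v) ≥ 0, and u - v is a quadratic with leading
coefficient -1/2. On integrating, the matched moments cancel, so M_{s+2} is less than the second
moment of the gamma weight. -/
theorem gamma_moment_comparison {s : ℝ} (hs : 0 < s) (y : ℝ) :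
    s * (gaussMellin s y * gaussMellin (s + 2) y) < (s + 1) * gaussMellin (s + 1) y ^ 2 := by
  have hM := gaussMellin_pos hs y
  have hM1 := gaussMellin_pos (s := s + 1) (by linarith) y
  set m := gaussMellin s y with hm
  set m1 := gaussMellin (s + 1) y with hm1
  -- The rate `l` and the factor `c` are fixed by matching these two moments (`v0`, `v1`).
  set l := s * m / m1 with hl
  have hlpos : 0 < l := by positivity
  have hG := Gamma_pos_of_pos hs
  set c := m * l ^ s / Gamma s with hc
  have hcpos : 0 < c := by positivity
  have hexp : ∀ t : ℝ, c * exp (-(l * t)) = exp (log c - l * t) := fun t => by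
    rw [sub_eq_add_neg, exp_add, exp_log hcpos]
  have hgi : ∀ a : ℝ, 0 < a →
      IntegrableOn (fun t : ℝ => t ^ (a - 1) * exp (log c - l * t)) (Ioi 0) := fun a ha => by
    have : IntegrableOn (fun t => c * (t ^ (a - 1) * exp (-l * t ^ (1 : ℝ)))) (Ioi 0) :=
      (integrableOn_rpow_mul_exp_neg_mul_rpow (s := a - 1) (p := 1) (by linarith) one_pos
      hlpos).const_mul c
    refine this.congr_fun (fun t _ => ?_) measurableSet_Ioi
    simp only [rpow_one, ← hexp, neg_mul]
    ring
  have hgv : ∀ a : ℝ, 0 < a →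
      ∫ t in Ioi (0 : ℝ), t ^ (a - 1) * exp (log c - l * t) = c * ((1 / l) ^ a * Gamma a) :=
    fun a ha => by
      rw [← integral_rpow_mul_exp_neg_mul_Ioi ha hlpos, ← integral_const_mul]
      refine setIntegral_congr_fun measurableSet_Ioi fun t _ => ?_
      simp only [← hexp]
      ring
  have h1l : (1 / l) ^ s * l ^ s = 1 := by
    rw [← mul_rpow (by positivity) hlpos.le, one_div_mul_cancel hlpos.ne', one_rpow]
  have v0 : c * ((1 / l) ^ s * Gamma s) = m := by
    calc _ = m * ((1 / l) ^ s * l ^ s) * (Gamma s / Gamma s) := by rw [hc]; ring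
      _ = m := by rw [h1l, div_self hG.ne']; ring
  have v1 : c * ((1 / l) ^ (s + 1) * Gamma (s + 1)) = m1 := by
    rw [rpow_add_one (by positivity), Gamma_add_one hs.ne']
    calc _ = c * ((1 / l) ^ s * Gamma s) * (s / l) := by ring
      _ = m1 := by rw [v0, hl]; field_simp
  have v2 : c * ((1 / l) ^ (s + 2) * Gamma (s + 2)) = (s + 1) * m1 ^ 2 / (s * m) := by
    rw [show s + 2 = s + 1 + 1 by ring, rpow_add_one (by positivity), Gamma_add_one (by linarith)]
    calc _ = c * ((1 / l) ^ (s + 1) * Gamma (s + 1)) * ((s + 1) / l) := by ring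
      _ = _ := by rw [v1, hl]; field_simp
  set a0 := -log c with ha0
  set b0 := l - y with hb0
  have hqi := integrableOn_quadratic_mul (hgi s hs) (hgi (s + 1) (by linarith))
    (hgi (s + 2) (by linarith)) a0 b0 (-(1 / 2))
  have hqv := integral_quadratic_mul (hgi s hs) (hgi (s + 1) (by linarith))
    (hgi (s + 2) (by linarith)) a0 b0 (-(1 / 2))
  rw [hgv s hs, hgv (s + 1) (by linarith), hgv (s + 2) (by linarith), v0, v1, v2] at hqv
  have hpi := integrableOn_quadratic_mul_gauss hs y a0 b0 (-(1 / 2))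
  have hpv := integral_quadratic_mul_gauss hs y a0 b0 (-(1 / 2))
  have hdiff : ∀ u v : ℝ, u ≠ v → 0 < (u - v) * (exp u - exp v) := by
    intro u v huv
    rcases lt_or_gt_of_ne huv with h | h
    · exact mul_pos_of_neg_of_neg (by linarith) (by linarith [exp_lt_exp.2 h])
    · exact mul_pos (by linarith) (by linarith [exp_lt_exp.2 h])
  have hform : ∀ t : ℝ,
      (a0 + b0 * t + -(1 / 2) * t ^ 2) * (t ^ (s - 1) * exp (-t ^ 2 / 2 - y * t)) -
        (a0 + b0 * t + -(1 / 2) * t ^ 2) * (t ^ (s - 1) * exp (log c - l * t)) =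
      t ^ (s - 1) * (((-t ^ 2 / 2 - y * t) - (log c - l * t)) *
        (exp (-t ^ 2 / 2 - y * t) - exp (log c - l * t))) := fun t => by
    rw [ha0, hb0]; ring
  have hfin : {t : ℝ | -t ^ 2 / 2 - y * t = log c - l * t}.Finite := by
    have hp : (Polynomial.C a0 + Polynomial.C b0 * Polynomial.X
        + Polynomial.C (-(1 / 2)) * Polynomial.X ^ 2 : Polynomial ℝ) ≠ 0 := fun h => by
      have := congrArg (fun p => Polynomial.coeff p 2) h
      simp at this
    refine (Polynomial.finite_setOfPred_isRoot hp).subset fun t ht => ?_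
    simp only [mem_ofPred_eq, Polynomial.IsRoot.def, Polynomial.eval_add, Polynomial.eval_mul,
      Polynomial.eval_C, Polynomial.eval_X, Polynomial.eval_pow] at ht ⊢
    rw [ha0, hb0]; linarith
  have key := setIntegral_Ioi_pos (hpi.sub hqi) hfin
    (fun t ht => by
      simp only [Pi.sub_apply]
      rw [hform]
      refine mul_nonneg (rpow_nonneg (le_of_lt ht) _) ?_
      rcases eq_or_ne (-t ^ 2 / 2 - y * t) (log c - l * t) with h | h
      · rw [h]; simp
      · exact (hdiff _ _ h).le)
    (fun t ht hts => by
      simp only [Pi.sub_apply]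
      rw [hform]
      exact mul_pos (rpow_pos_of_pos ht _) (hdiff _ _ hts))
  simp only [Pi.sub_apply] at key
  rw [integral_sub hpi hqi, hqv, hpv] at key
  have h2 : gaussMellin (s + 2) y < (s + 1) * m1 ^ 2 / (s * m) := by linarith
  rw [lt_div_iff₀ (by positivity)] at h2
  linarith

/-! ### Behaviour for large |y| -/

theorem hasDerivAt_gaussMellin {s : ℝ} (hs : 0 < s) (y : ℝ) :
    HasDerivAt (gaussMellin s) (-gaussMellin (s + 1) y) y := by
  have hbound := integrableOn_gaussMellin (s := s + 1) (by linarith) (y - 1)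
  have h := (hasDerivAt_integral_of_dominated_loc_of_deriv_le
    (μ := volume.restrict (Ioi (0 : ℝ))) (x₀ := y) (s := Metric.ball y 1)
    (F := fun y t => t ^ (s - 1) * exp (-t ^ 2 / 2 - y * t))
    (F' := fun y t => -(t ^ (s + 1 - 1) * exp (-t ^ 2 / 2 - y * t)))
    (Metric.ball_mem_nhds y one_pos)
    (Eventually.of_forall fun z => (integrableOn_gaussMellin hs z).aestronglyMeasurable)
    (integrableOn_gaussMellin hs y)
    (integrableOn_gaussMellin (s := s + 1) (by linarith) y).neg.aestronglyMeasurable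
    ((ae_restrict_iff' measurableSet_Ioi).2 (ae_of_all _ fun t ht z hz => ?_)) hbound
    ((ae_restrict_iff' measurableSet_Ioi).2 (ae_of_all _ fun t ht z hz => ?_))).2
  · rw [integral_neg] at h
    exact h
  · have ht0 : 0 < t ^ (s + 1 - 1) := rpow_pos_of_pos ht _
    rw [norm_neg, norm_of_nonneg (by positivity)]
    have hz' := abs_lt.1 (by simpa [dist_eq] using hz)
    have : (y - 1) * t ≤ z * t := mul_le_mul_of_nonneg_right (by linarith) (le_of_lt ht)
    gcongr
  · have h2 : HasDerivAt (fun z : ℝ => -t ^ 2 / 2 - z * t) (-t) z := by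
      simpa using ((hasDerivAt_id z).mul_const t).const_sub (-t ^ 2 / 2)
    refine (h2.exp.const_mul (t ^ (s - 1))).congr_deriv ?_
    rw [rpow_add_one_sub_one ht]; ring

/-- Multiply the two inequalities that the recurrence extracts from M_{s+2} > 0 and M_{s+4} > 0. -/
theorem gaussMellin_sq_mul_lt {s y : ℝ} (hs : 0 < s) (hy : 0 < y) :
    (s + 1) * y ^ 2 * gaussMellin (s + 1) y ^ 2 <
      s * (y ^ 2 + s + 2) * (gaussMellin s y * gaussMellin (s + 2) y) := by
  have h0 := gaussMellin_pos hs y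
  have h1 := gaussMellin_pos (s := s + 1) (by linarith) y
  have h2 := gaussMellin_pos (s := s + 2) (by linarith) y
  have h4 := gaussMellin_pos (s := s + 2 + 2) (by linarith) y
  have e2 := gaussMellin_add_two hs y
  have e3 := gaussMellin_add_two (s := s + 1) (by linarith) y
  have e4 := gaussMellin_add_two (s := s + 2) (by linarith) y
  rw [show s + 1 + 2 = s + 2 + 1 by ring, show s + 1 + 1 = s + 2 by ring] at e3
  rw [e4, e3] at h4
  have a : y * gaussMellin (s + 1) y < s * gaussMellin s y := by linarith
  have b : y * (s + 1) * gaussMellin (s + 1) y < (y ^ 2 + s + 2) * gaussMellin (s + 2) y := by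
    linarith
  have := mul_lt_mul'' a b (by positivity) (by positivity)
  linarith

/-- Otherwise r = M_{s+1}/M_s at y = -Y satisfies (log r)' = M_{s+2}/M_{s+1} - r ≥ (1-k)
M_{s+2}/M_{s+1} ≥ (1-k) Y for Y ≥ 0, so `F` is monotone there. -/
theorem exists_gaussMellin_sq_gt {s k : ℝ} (hs : 0 < s) (hk : k < 1) :
    ∃ y, k * (gaussMellin s y * gaussMellin (s + 2) y) < gaussMellin (s + 1) y ^ 2 := by
  by_contra! H
  have p0 := gaussMellin_pos hs
  have p1 := gaussMellin_pos (s := s + 1) (by linarith)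
  have e2 := gaussMellin_add_two hs
  set F : ℝ → ℝ := fun Y => log (gaussMellin (s + 1) (-Y)) - log (gaussMellin s (-Y)) -
    (1 - k) * Y ^ 2 / 2 with hF
  have hd : ∀ Y, HasDerivAt F (gaussMellin (s + 2) (-Y) / gaussMellin (s + 1) (-Y) -
      gaussMellin (s + 1) (-Y) / gaussMellin s (-Y) - (1 - k) * Y) Y := by
    intro Y
    have d0 := ((hasDerivAt_gaussMellin hs (-Y)).comp Y (hasDerivAt_neg Y)).log (p0 _).ne'
    have d1 := ((hasDerivAt_gaussMellin (s := s + 1) (by linarith) (-Y)).comp Y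
      (hasDerivAt_neg Y)).log (p1 _).ne'
    have d2 := (((hasDerivAt_id Y).pow 2).const_mul (1 - k)).div_const 2
    refine ((d1.sub d0).sub d2).congr_deriv ?_
    rw [show s + 1 + 1 = s + 2 by ring]
    simp only [Function.comp, id_eq]
    norm_num
    ring
  have hmono : MonotoneOn F (Ici 0) := by
    refine monotoneOn_of_deriv_nonneg (convex_Ici 0)
      (fun Y _ => (hd Y).continuousAt.continuousWithinAt)
      (fun Y _ => (hd Y).differentiableAt.differentiableWithinAt) fun Y hY => ?_
    rw [(hd Y).deriv]
    have hq : gaussMellin (s + 1) (-Y) / gaussMellin s (-Y) ≤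
        k * (gaussMellin (s + 2) (-Y) / gaussMellin (s + 1) (-Y)) := by
      rw [← mul_div_assoc, div_le_div_iff₀ (p0 _) (p1 _)]
      linarith [H (-Y)]
    have hY2 : Y ≤ gaussMellin (s + 2) (-Y) / gaussMellin (s + 1) (-Y) := by
      rw [le_div_iff₀ (p1 _), e2]
      linarith [mul_pos hs (p0 (-Y))]
    nlinarith [mul_le_mul_of_nonneg_left hY2 (sub_pos.2 hk).le]
  have hup : ∀ Y, 0 ≤ Y →
      log (gaussMellin (s + 1) (-Y)) - log (gaussMellin s (-Y)) ≤ Y + s := by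
    intro Y hY
    rw [← log_div (p1 _).ne' (p0 _).ne']
    set r := gaussMellin (s + 1) (-Y) / gaussMellin s (-Y) with hr
    have hrp : 0 < r := div_pos (p1 _) (p0 _)
    have hrM : gaussMellin (s + 1) (-Y) = r * gaussMellin s (-Y) :=
      (div_mul_cancel₀ _ (p0 _).ne').symm
    have hcs := gaussMellin_sq_lt hs (-Y)
    rw [e2, hrM] at hcs
    -- Cauchy–Schwarz and the recurrence bound r linearly; then log r ≤ r - 1.
    have hr2 : r ^ 2 < s + Y * r := by
      have : 0 < gaussMellin s (-Y) ^ 2 * (s + Y * r - r ^ 2) := by linarith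
      linarith [pos_of_mul_pos_right this (sq_nonneg _)]
    have hr3 : r ≤ Y + s + 1 := by
      by_contra! h
      nlinarith
    linarith [log_le_sub_one_of_pos hrp]
  have hk' : 0 < 1 - k := by linarith
  set A := |F 0| + s + 1 with hA
  have hA1 : 1 ≤ A := by linarith [abs_nonneg (F 0)]
  -- Large enough that F Y ≤ Y + s - (1-k)Y²/2 < s - A·Y ≤ -|F 0| - 1, against monotonicity.
  set Y := 2 * (A + 1) / (1 - k) + 1 with hY
  have hY1 : 1 ≤ Y := by
    have : 0 ≤ 2 * (A + 1) / (1 - k) := by positivity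
    linarith
  have hkY : 2 * (A + 1) < (1 - k) * Y := by
    rw [hY, mul_add (1 - k), mul_div_cancel₀ _ hk'.ne']
    linarith
  have h1 := hmono (mem_Ici.2 le_rfl) (mem_Ici.2 (by linarith : (0 : ℝ) ≤ Y)) (by linarith)
  have h2 := hup Y (by linarith)
  have h3 : F Y ≤ Y + s - (1 - k) * Y ^ 2 / 2 := by
    simp only [hF]; linarith
  have h4 := neg_abs_le (F 0)
  nlinarith [mul_lt_mul_of_pos_right hkY (by linarith : 0 < Y)]

/-! ### Return to Hermite functions -/

theorem hermiteH_eq_gaussMellin (ν x : ℝ) :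
    hermiteH ν x = (2 : ℝ) ^ (ν / 2) / Gamma (-ν) * gaussMellin (-ν) (√2 * x) := by
  have he : exp (x ^ 2 / 2) * exp (-(√2 * x) ^ 2 / 4) = 1 := by
    rw [← exp_add, mul_pow, sq_sqrt (by norm_num)]
    ring_nf
    exact exp_zero
  unfold hermiteH parabolicCylinderD gaussMellin
  calc _ = (2 : ℝ) ^ (ν / 2) / Gamma (-ν) *
        (∫ t in Ioi (0 : ℝ), t ^ (-ν - 1) * exp (-t ^ 2 / 2 - √2 * x * t)) *
        (exp (x ^ 2 / 2) * exp (-(√2 * x) ^ 2 / 4)) := by ring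
    _ = _ := by rw [he, mul_one]

theorem hermiteH_pos {ν : ℝ} (hν : ν < 0) (x : ℝ) : 0 < hermiteH ν x := by
  rw [hermiteH_eq_gaussMellin]
  have := Gamma_pos_of_pos (neg_pos.2 hν)
  have := gaussMellin_pos (neg_pos.2 hν) (√2 * x)
  positivity

theorem hermiteRatio_eq_gaussMellin {s : ℝ} (hs : 0 < s) (x : ℝ) :
    hermiteRatio (-s) x = (s + 1) * gaussMellin (s + 1) (√2 * x) ^ 2 /
      (s * (gaussMellin s (√2 * x) * gaussMellin (s + 2) (√2 * x))) := by
  have hG := Gamma_pos_of_pos hs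
  have p0 := gaussMellin_pos hs (√2 * x)
  have p2 := gaussMellin_pos (s := s + 2) (by linarith) (√2 * x)
  have g1 := Gamma_add_one hs.ne'
  have g2 : Gamma (s + 2) = (s + 1) * (s * Gamma s) := by
    rw [show s + 2 = s + 1 + 1 by ring, Gamma_add_one (by linarith), g1]
  have hp : (2 : ℝ) ^ (-s / 2) * (2 : ℝ) ^ ((-s - 2) / 2) = ((2 : ℝ) ^ ((-s - 1) / 2)) ^ 2 := by
    rw [sq, ← rpow_add (by norm_num), ← rpow_add (by norm_num)]
    ring_nf
  have q0 : 0 < (2 : ℝ) ^ (-s / 2) := by positivity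
  have q2 : 0 < (2 : ℝ) ^ ((-s - 2) / 2) := by positivity
  unfold hermiteRatio
  simp only [hermiteH_eq_gaussMellin]
  rw [show -(-s - 1) = s + 1 by ring, show -(-s - 2) = s + 2 by ring, neg_neg, g1, g2,
    mul_pow, div_pow, ← hp]
  field_simp

theorem corollary2 (ν : ℝ) (hν : ν < 0) :
    (∀ x : ℝ, 1 < hermiteRatio ν x ∧ hermiteRatio ν x < (ν - 1) / ν) ∧
    IsGLB (Set.range (hermiteRatio ν)) 1 ∧
    IsLUB (Set.range (hermiteRatio ν)) ((ν - 1) / ν) ∧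
    (∀ x : ℝ, 0 < hermiteH (ν - 1) x ^ 2 - hermiteH ν x * hermiteH (ν - 2) x) := by
  obtain ⟨s, rfl⟩ : ∃ s, ν = -s := ⟨-ν, (neg_neg ν).symm⟩
  have hs : 0 < s := by linarith
  have p0 := gaussMellin_pos hs
  have p2 := gaussMellin_pos (s := s + 2) (by linarith)
  have hsurj : ∀ y : ℝ, ∃ x, √2 * x = y := fun y => ⟨y / √2, mul_div_cancel₀ y (by positivity)⟩
  have hR := hermiteRatio_eq_gaussMellin hs
  have hden : ∀ y, 0 < s * (gaussMellin s y * gaussMellin (s + 2) y) := fun y =>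
    mul_pos hs (mul_pos (p0 y) (p2 y))
  have hb : (-s - 1) / -s = (s + 1) / s := by
    rw [← neg_div_neg_eq]; ring_nf
  rw [hb]
  have hbounds : ∀ x : ℝ, 1 < hermiteRatio (-s) x ∧ hermiteRatio (-s) x < (s + 1) / s := by
    intro x
    rw [hR]
    refine ⟨(one_lt_div (hden _)).2 (gamma_moment_comparison hs _), ?_⟩
    rw [div_lt_div_iff₀ (hden _) hs]
    have h := mul_pos (mul_pos hs (by linarith : 0 < s + 1))
      (sub_pos.2 (gaussMellin_sq_lt hs (√2 * x)))
    linarith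
  refine ⟨hbounds, ⟨?_, fun b hb => ?_⟩, ⟨?_, fun b hb => ?_⟩, fun x => ?_⟩
  · rintro _ ⟨x, rfl⟩
    exact (hbounds x).1.le
  · by_contra! hb1
    have hb1' : 0 < b - 1 := by linarith
    have hq : 0 < (s + 2) / (b - 1) := by positivity
    -- At this y the bound 1 + (s+2)/y² on the ratio drops below b, since y > 1 and (b-1)y > s+2.
    obtain ⟨x, hx⟩ := hsurj ((s + 2) / (b - 1) + 1)
    have hbx := hb ⟨x, rfl⟩
    rw [hR, hx, le_div_iff₀ (hden _)] at hbx
    set y := (s + 2) / (b - 1) + 1 with hy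
    have hlt := gaussMellin_sq_mul_lt (y := y) hs (by linarith)
    have hby : s + 2 < (b - 1) * y := by
      rw [hy, mul_add, mul_div_cancel₀ _ hb1'.ne']; linarith
    have hy2 : y ^ 2 + s + 2 < b * y ^ 2 := by
      nlinarith [mul_lt_mul_of_pos_left (show 1 < y by linarith)
        (mul_pos hb1' (show 0 < y by linarith))]
    nlinarith [mul_lt_mul_of_pos_right hy2 (hden y),
      mul_le_mul_of_nonneg_left hbx (sq_nonneg y)]
  · rintro _ ⟨x, rfl⟩
    exact (hbounds x).2.le
  · by_contra! hb1
    have hk : b * s / (s + 1) < 1 := by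
      rw [lt_div_iff₀ hs] at hb1
      rw [div_lt_one (by linarith)]
      exact hb1
    obtain ⟨y, hy⟩ := exists_gaussMellin_sq_gt hs hk
    obtain ⟨x, rfl⟩ := hsurj y
    have hbx := hb ⟨x, rfl⟩
    rw [hR, div_le_iff₀ (hden _)] at hbx
    rw [div_mul_eq_mul_div, div_lt_iff₀ (by linarith)] at hy
    linarith
  · have h := (hbounds x).1
    unfold hermiteRatio at h
    rw [one_lt_div (mul_pos (hermiteH_pos hν x) (hermiteH_pos (by linarith) x))] at h
    linarith
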